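/- A shelf shuffler with $m\ge 1$ shelves acts on a deck of $n$ cards, initially in order $1,2,\dots,n$ from top to bottom, as follows. The cards are dealt one at a time from the bottom of the deck; each card is put on a shelf chosen uniformly at random among the $m$ shelves, and is placed on the top or on the bottom of the pile already on that shelf with probability $1/2$ each, all choices being independent. At the end the piles are stacked, in the order of the shelves, into one deck. For $w\in S_n$ let $P_m(w)$ be the probability that, for every $i$, the card in position $i$ (from the top) of the final deck is $w(i)$, and let $U(w)=1/n!$. For a probability $P$ on $S_n$ put $$\|P-U\|_\infty=\max_{w\in S_n}\left|1-\frac{P(w)}{U(w)}\right|,\qquad \mathrm{sep}(P)=\max_{w\in S_n}\left(1-\frac{P(w)}{U(w)}\right).$$ **Theorem.** Let $0<c<\infty$ be fixed, and let $m=m(n)$ be non-negative integers with $m(n)/n^{3/2}\to c$ as $n\to\infty$ (for example $m(n)=\lfloor cn^{3/2}\rfloor$; in particular this covers $m=cn^{3/2}$ along any $n\to\infty$ for which $cn^{3/2}$ is an integer). Then, as $n\to\infty$, $$\|P_m-U\|_\infty\sim e^{1/(12c^2)}-1,\qquad \mathrm{sep}(P_m)\sim 1-e^{-1/(24c^2)}.$$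 -/

import Mathlib

open Filter Topology Asymptotics

namespace ShelfShuffle

/-- The random choices made by a shelf shuffler with `m` shelves and `n` cards. Card `i`
(cards are numbered from the top of the deck, starting at `0`) is put on shelf `(g i).1`,
on top of the pile on that shelf if `(g i).2 = true` and below it if `(g i).2 = false`. -/
abbrev Choices (n m : ℕ) : Type := Fin n → Fin m × Bool

/-- Put card `i` on its shelf, above or below the cards that are already there.
Piles are listed from top to bottom. -/
def place {n m : ℕ} (g : Choices n m) (i : Fin n) (s : Fin m → List (Fin n)) :
    Fin m → List (Fin n) :=
  Function.update s (g i).1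
    (if (g i).2 then i :: s (g i).1 else s (g i).1 ++ [i])

/-- Deal the cards of the deck `l` (listed from top to bottom) onto empty shelves, starting
with the bottom card: `List.foldr` handles the last card of `l` first. -/
def deal {n m : ℕ} (g : Choices n m) (l : List (Fin n)) : Fin m → List (Fin n) :=
  l.foldr (place g) (fun _ => [])

/-- The final deck, from top to bottom: the piles are stacked in the order of the shelves. -/
def deck {n m : ℕ} (g : Choices n m) : List (Fin n) :=
  (List.finRange m).flatMap (deal g (List.finRange n))

/-- Each pile consists of the cards that were placed on top, in their original relative order,
followed by the cards that were placed below, in reversed order. -/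
theorem deal_apply {n m : ℕ} (g : Choices n m) (l : List (Fin n)) (j : Fin m) :
    deal g l j = l.filter (fun i => g i = (j, true)) ++
      (l.filter (fun i => g i = (j, false))).reverse := by
  induction l with
  | nil => rfl
  | cons i l ih =>
    have h : deal g (i :: l) = place g i (deal g l) := rfl
    rw [h, place]
    rcases hg : g i with ⟨k, b⟩
    by_cases hk : j = k
    · subst hk
      cases b <;> simp [ih, hg]
    · have hk' : ¬ k = j := fun e => hk e.symm
      cases b <;> simp [ih, hg, Function.update_of_ne hk, hk']

theorem mem_deal {n m : ℕ} (g : Choices n m) (j : Fin m) (i : Fin n) :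
    i ∈ deal g (List.finRange n) j ↔ (g i).1 = j := by
  rw [deal_apply]
  rcases hg : g i with ⟨k, b⟩
  cases b <;> simp [hg]

theorem mem_deck {n m : ℕ} (g : Choices n m) (i : Fin n) : i ∈ deck g := by
  simp [deck, List.mem_flatMap, mem_deal]

theorem nodup_deck {n m : ℕ} (g : Choices n m) : (deck g).Nodup := by
  refine List.nodup_flatMap.2 ⟨fun j _ => ?_, ?_⟩
  · rw [deal_apply]
    refine List.Nodup.append ((List.nodup_finRange n).filter _)
      (List.nodup_reverse.2 ((List.nodup_finRange n).filter _)) ?_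
    intro i h₁ h₂
    simp at h₁ h₂
    simp [h₁] at h₂
  · refine (List.nodup_finRange m).imp ?_
    intro j k hjk i h₁ h₂
    rw [mem_deal] at h₁ h₂
    exact hjk (h₁.symm.trans h₂)

theorem length_deck {n m : ℕ} (g : Choices n m) : (deck g).length = n := by
  have h := Fintype.card_congr ((nodup_deck g).getEquivOfForallMemList _ (mem_deck g))
  simpa using h

/-- The final order as a permutation: `perm g i` is the card in position `i` from the top. -/
def perm {n m : ℕ} (g : Choices n m) : Equiv.Perm (Fin n) :=
  (finCongr (length_deck g).symm).trans
    ((nodup_deck g).getEquivOfForallMemList _ (mem_deck g))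

theorem ofFn_perm {n m : ℕ} (g : Choices n m) : List.ofFn (perm g) = deck g := by
  apply List.ext_getElem
  · simp [length_deck]
  · intro i h₁ h₂
    simp [perm]

/-- The shelf shuffling measure `P_m` on permutations of `n` cards: all `(2 m) ^ n` choices of
shelves and sides (independent and uniform for each card) are equally likely, and
`P_m (w)` is the chance that the final order is `w`. -/
noncomputable def measure (n m : ℕ) (w : Equiv.Perm (Fin n)) : ℝ :=
  ((Finset.univ.filter fun g : Choices n m => perm g = w).card : ℝ) / (2 * (m : ℝ)) ^ n

/-- With at least one shelf, the shelf shuffling measure has total mass one. -/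
theorem sum_measure (n m : ℕ) (hm : 0 < m) : ∑ w, measure n m w = 1 := by
  have h := Finset.card_eq_sum_card_fiberwise
    (s := (Finset.univ : Finset (Choices n m))) (t := Finset.univ)
    (f := perm) (fun _ _ => by simp)
  have hc : ((Finset.univ : Finset (Choices n m)).card : ℝ) = (2 * (m : ℝ)) ^ n := by
    simp [mul_comm]
  have hpos : (0 : ℝ) < (2 * (m : ℝ)) ^ n := by positivity
  simp only [measure]
  rw [← Finset.sum_div, ← Nat.cast_sum, ← h, hc, div_self hpos.ne']

/-- The uniform distribution on permutations of `n` objects. -/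
noncomputable def uniform (n : ℕ) (_w : Equiv.Perm (Fin n)) : ℝ := 1 / (n.factorial : ℝ)

/-- The separation distance of `P` from uniform. -/
noncomputable def sep {n : ℕ} (P : Equiv.Perm (Fin n) → ℝ) : ℝ :=
  Finset.univ.sup' Finset.univ_nonempty fun w => 1 - P w / uniform n w

/-- The `l_∞` distance of `P` from uniform. -/
noncomputable def linfDist {n : ℕ} (P : Equiv.Perm (Fin n) → ℝ) : ℝ :=
  Finset.univ.sup' Finset.univ_nonempty fun w => |1 - P w / uniform n w|

end ShelfShuffle

/-! Each shelf consists of two half-shelves: the upper one keeps the original order of its cards,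
the lower one reverses it. A choice `g` produces `w` exactly when each card of `w` may sit directly
above the next one, so `P_m(w)` counts chains of half-shelves whose allowed steps depend only on the
ascent pattern of `w` (`perm_eq_iff`, `card_perm_eq`). A transfer recursion, read as a generating
function in the number of shelves, gives `2X(4X)^v(1+X)^r/(1-X)^(k+2)`, where `n = k + 1`, `v` is
the number of valleys and `k = 2v + r` (`card_chains_eq_coeff`). Expanding `(1+X)^r` turns the
density of `P_m` into the mean of `∏ (1 + (i - (n-1)/2 - B)/m)` over a centred binomial `B` with `r`
trials (`measure_div_uniform`).

Put `θ = n/m`, so that `nθ² → 1/c²`. To second order the logarithm of the product is `-θB -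
n³/(24m²)`; the term in `B²` is negligible because `B` has order at most `√n`. The density is
therefore close to `exp(-1/(24c²)) * cosh(θ/2)^r`, whose exponent is about `-1/(24c²) +
(r/n)/(8c²)`. The extremes are `r = n - 1`, at the identity, with exponent `1/(12c²)`, and `r ≤ 1`,
at an alternating permutation, with exponent `-1/(24c²)`. -/

namespace ShelfShuffle

/-! ### Reduction to counting chains of half-shelves -/

/-- Whether a card on half-shelf `y` can be directly above a card on half-shelf `x` in the final
deck, where `s` tells whether the upper card has the smaller number. -/
def Follows {m : ℕ} (s : Bool) (y x : Fin m × Bool) : Prop :=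
  y.1 < x.1 ∨ y.1 = x.1 ∧ (if s then y.2 = true else x.2 = false)

instance {m : ℕ} (s : Bool) (y x : Fin m × Bool) : Decidable (Follows s y x) := by
  unfold Follows; infer_instance

/-- The order in which the cards appear in the final deck. -/
def Precedes {n m : ℕ} (g : Choices n m) (i i' : Fin n) : Prop :=
  Follows (decide (i < i')) (g i) (g i')

/-- Transitivity is what lets `perm_eq_iff` test only neighbouring positions. -/
instance {n m : ℕ} (g : Choices n m) : IsTrans (Fin n) (Precedes g) where
  trans i j k hij hjk := by
    simp only [Precedes, Follows] at *
    rcases hij with hij | ⟨hij, h1⟩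
    · rcases hjk with hjk | ⟨hjk, h2⟩
      · exact Or.inl (hij.trans hjk)
      · exact Or.inl (hjk ▸ hij)
    · rcases hjk with hjk | ⟨hjk, h2⟩
      · exact Or.inl (hij ▸ hjk)
      · refine Or.inr ⟨hij.trans hjk, ?_⟩
        by_cases a : i < j <;> by_cases b : j < k <;> by_cases c : i < k <;> simp_all
        · exact absurd (a.trans b) (not_lt.2 c)
        · exact absurd (c.trans_le b) (not_lt.2 a)

theorem precedes_antisymm {n m : ℕ} (g : Choices n m) (i j : Fin n) (hij : Precedes g i j)
    (hji : Precedes g j i) : i = j := by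
  simp only [Precedes, Follows] at *
  rcases hij with hij | ⟨hij, h1⟩
  · rcases hji with hji | ⟨hji, h2⟩
    · exact absurd hji (not_lt.2 hij.le)
    · exact absurd hji hij.ne'
  · rcases hji with hji | ⟨hji, h2⟩
    · exact absurd hij hji.ne'
    · rcases lt_trichotomy i j with h | h | h
      · simp_all [not_lt.2 h.le]
      · exact h
      · simp_all [not_lt.2 h.le]

theorem pairwise_deck {n m : ℕ} (g : Choices n m) : (deck g).Pairwise (Precedes g) := by
  have hs : (List.finRange n).Pairwise (· < ·) := List.pairwise_lt_finRange n
  refine List.pairwise_flatMap.2 ⟨fun j _ => ?_, ?_⟩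
  · rw [deal_apply, List.pairwise_append]
    refine ⟨?_, ?_, ?_⟩
    · rw [List.pairwise_filter]
      refine hs.imp ?_
      intro a b hab ha hb
      simp_all [Precedes, Follows]
    · rw [List.pairwise_reverse, List.pairwise_filter]
      refine hs.imp ?_
      intro a b hab ha hb
      simp_all [Precedes, Follows, not_lt.2 hab.le]
    · intro a ha b hb
      simp only [List.mem_filter, List.mem_reverse, decide_eq_true_eq] at ha hb
      simp [Precedes, Follows, ha.2, hb.2]
  · refine (List.pairwise_lt_finRange m).imp ?_
    intro j k hjk a ha b hb
    rw [mem_deal] at ha hb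
    exact Or.inl (by rw [ha, hb]; exact hjk)

/-- The relation `Precedes g` is antisymmetric and `deck g` is sorted by it, so `deck g` is the only
sorted arrangement of the cards. -/
theorem perm_eq_iff {k m : ℕ} (g : Choices (k + 1) m) (w : Equiv.Perm (Fin (k + 1))) :
    perm g = w ↔ ∀ i : Fin k, Precedes g (w i.castSucc) (w i.succ) := by
  rw [← Fin.liftFun_iff_succ (Precedes g)]
  have key : Relator.LiftFun (· < ·) (Precedes g) (w : Fin (k + 1) → Fin (k + 1)) w ↔
      (List.ofFn w).Pairwise (Precedes g) := by
    rw [List.pairwise_ofFn]; rfl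
  rw [key]
  constructor
  · rintro rfl
    rw [ofFn_perm]
    exact pairwise_deck g
  · intro h
    have hw : (List.ofFn w).Nodup := List.nodup_ofFn.2 w.injective
    have hp : (List.ofFn (perm g)).Perm (List.ofFn w) := by
      rw [ofFn_perm]
      refine (List.perm_ext_iff_of_nodup (nodup_deck g) hw).2 fun a => ?_
      simp only [mem_deck, true_iff, List.mem_ofFn]
      exact w.surjective a
    have := hp.eq_of_pairwise (le := Precedes g) (fun a b _ _ => precedes_antisymm g a b)
      (by rw [ofFn_perm]; exact pairwise_deck g) h
    exact Equiv.coe_fn_injective (List.ofFn_injective this)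

/-- The ascents of `w` as a Boolean sequence. -/
def ascents {k : ℕ} (w : Equiv.Perm (Fin (k + 1))) (i : ℕ) : Bool :=
  if h : i < k then decide (w (Fin.castSucc ⟨i, h⟩) < w (Fin.succ ⟨i, h⟩)) else true

/-- The sequences of half-shelves compatible with a given sequence of ascents. -/
def chains (s : ℕ → Bool) (k m : ℕ) : Finset (Choices (k + 1) m) :=
  Finset.univ.filter fun h => ∀ i : Fin k, Follows (s i) (h i.castSucc) (h i.succ)

/-- Reindexing choices by position instead of by card, `g ↦ g ∘ w`, leaves only the ascent pattern
of `w` in the condition. -/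
theorem card_perm_eq {k m : ℕ} (w : Equiv.Perm (Fin (k + 1))) :
    (Finset.univ.filter fun g : Choices (k + 1) m => perm g = w).card =
      (chains (ascents w) k m).card := by
  refine Finset.card_equiv (Equiv.arrowCongr w.symm (Equiv.refl _)) fun g => ?_
  simp [chains, perm_eq_iff, ascents, Precedes]

/-- The number of prefixes of length `k + 1` that end on half-shelf `(j, b)`. -/
def prefixCount (s : ℕ → Bool) : ℕ → ℕ → Bool → ℕ
  | 0, _, _ => 1
  | k + 1, j, b => ∑ i ∈ Finset.range j, (prefixCount s k i true + prefixCount s k i false) +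
      ((if s k || !b then prefixCount s k j true else 0) +
        if !s k && !b then prefixCount s k j false else 0)

/-- One step of the transfer recursion: all earlier shelves contribute, and on the same shelf an
ascent must leave the upper half while a descent must enter the lower half. -/
theorem sum_follows {m : ℕ} (s : Bool) (x : Fin m × Bool) (F : ℕ → Bool → ℕ) :
    ∑ y : Fin m × Bool, (if Follows s y x then F y.1 y.2 else 0) =
      ∑ i ∈ Finset.range x.1, (F i true + F i false) +
        ((if s || !x.2 then F x.1 true else 0) + if !s && !x.2 then F x.1 false else 0) := by
  obtain ⟨j, b⟩ := x
  rw [Fintype.sum_prod_type]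
  simp only [Fintype.sum_bool]
  have h : ∀ y : Fin m, ((if Follows s (y, true) (j, b) then F y true else 0) +
      if Follows s (y, false) (j, b) then F y false else 0) =
      (if (y : ℕ) < j then F y true + F y false else 0) +
      (if (y : ℕ) = j then ((if s || !b then F j true else 0) +
        if !s && !b then F j false else 0) else 0) := by
    intro y
    rcases lt_trichotomy y j with h | h | h
    · have h' : (y : ℕ) < j := h
      simp [Follows, h, h', h'.ne]
    · subst h
      cases s <;> cases b <;> simp [Follows]
    · have h' : (j : ℕ) < y := h
      simp [Follows, h.ne', not_lt.2 h.le, h'.ne', not_lt.2 h'.le]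
  rw [Finset.sum_congr rfl fun y _ => h y, Finset.sum_add_distrib]
  congr 1
  · rw [Fin.sum_univ_eq_sum_range (fun y => if y < (j : ℕ) then F y true + F y false else 0) m,
      ← Finset.sum_filter]
    congr 1
    ext i
    simp only [Finset.mem_filter, Finset.mem_range]
    exact ⟨fun h => h.2, fun h => ⟨h.trans j.2, h⟩⟩
  · simp [Fin.val_inj]

theorem card_chains_last (s : ℕ → Bool) (k m : ℕ) (x : Fin m × Bool) :
    ((chains s k m).filter fun h => h (Fin.last k) = x).card = prefixCount s k x.1 x.2 := by
  induction k generalizing x with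
  | zero =>
    rw [prefixCount, Finset.card_eq_one]
    refine ⟨fun _ => x, ?_⟩
    ext h
    simp only [chains, Finset.mem_filter, Finset.mem_univ, true_and, Finset.mem_singleton]
    constructor
    · rintro ⟨-, h2⟩
      funext i
      rw [← h2, Fin.eq_zero i]; rfl
    · rintro rfl
      exact ⟨fun i => i.elim0, rfl⟩
  | succ k ih =>
    have h1 : ((chains s (k + 1) m).filter fun h => h (Fin.last (k + 1)) = x).card =
        ((chains s k m).filter fun h => Follows (s k) (h (Fin.last k)) x).card := by
      refine Finset.card_nbij' (fun h => Fin.init h) (fun h => Fin.snoc h x) ?_ ?_ ?_ ?_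
      · intro h hh
        simp only [chains, Finset.coe_filter, Finset.mem_filter, Finset.mem_univ, true_and,
          Set.mem_ofPred_eq] at hh ⊢
        obtain ⟨ha, rfl⟩ := hh
        refine ⟨fun i => ?_, ?_⟩
        · have := ha i.castSucc
          simpa [Fin.init] using this
        · have := ha (Fin.last k)
          simpa [Fin.init] using this
      · intro h hh
        simp only [chains, Finset.coe_filter, Finset.mem_filter, Finset.mem_univ, true_and,
          Set.mem_ofPred_eq] at hh ⊢
        refine ⟨fun i => ?_, by simp⟩
        refine Fin.lastCases ?_ (fun i => ?_) i
        · simpa using hh.2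
        · have := hh.1 i
          rw [← Fin.castSucc_succ]
          simpa only [Fin.snoc_castSucc, Fin.val_castSucc] using this
      · intro h hh
        simp only [Finset.coe_filter, Set.mem_ofPred_eq] at hh
        simp only
        rw [← hh.2, Fin.snoc_init_self]
      · intro h _
        simp
    rw [h1, prefixCount, ← sum_follows (s k) x (prefixCount s k),
      Finset.card_eq_sum_card_fiberwise (f := fun h => h (Fin.last k)) (t := Finset.univ)
        (fun _ _ => by simp)]
    refine Finset.sum_congr rfl fun y _ => ?_
    rw [← ih y]
    split_ifs with hy
    · congr 1
      ext h
      simp only [Finset.mem_filter]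
      constructor
      · rintro ⟨⟨a, -⟩, c⟩; exact ⟨a, c⟩
      · rintro ⟨a, c⟩; exact ⟨⟨a, c ▸ hy⟩, c⟩
    · rw [Finset.card_eq_zero, Finset.filter_eq_empty_iff]
      rintro h hh rfl
      exact hy (Finset.mem_filter.1 hh).2

theorem card_chains (s : ℕ → Bool) (k m : ℕ) :
    (chains s k m).card =
      ∑ j ∈ Finset.range m, (prefixCount s k j true + prefixCount s k j false) := by
  rw [Finset.card_eq_sum_card_fiberwise (f := fun h => h (Fin.last k)) (t := Finset.univ)
        (fun _ _ => by simp)]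
  simp only [card_chains_last]
  rw [Fintype.sum_prod_type]
  simp only [Fintype.sum_bool]
  exact Fin.sum_univ_eq_sum_range (fun j => prefixCount s k j true + prefixCount s k j false) m

end ShelfShuffle

/-! ### Generating function in the number of shelves -/

namespace ShelfShuffle

open PowerSeries in
-- `mk 1` is `1/(1-X)`; the sum over strictly earlier shelves gives the extra factor `X`.
theorem mk_sum_range (a : ℕ → ℝ) :
    (mk fun j => ∑ i ∈ Finset.range j, a i) = X * (mk 1 * mk a) := by
  ext j
  cases j with
  | zero => simp
  | succ j =>
    rw [coeff_succ_X_mul, mul_comm, coeff_mul, coeff_mk,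
      Finset.Nat.sum_antidiagonal_eq_sum_range_succ_mk]
    simp

/-- The previous comparison, where the first card counts as preceded by an ascent. -/
def prevAscent (s : ℕ → Bool) : ℕ → Bool
  | 0 => true
  | k + 1 => s k

/-- The number of descents directly followed by an ascent among the first `k` comparisons. -/
def valleys (s : ℕ → Bool) : ℕ → ℕ
  | 0 => 0
  | k + 1 => valleys s k + if !prevAscent s k && s k then 1 else 0

/-- The generating function of `prefixCount` over the shelves. -/
noncomputable def prefixSeries (s : ℕ → Bool) (k : ℕ) (b : Bool) : PowerSeries ℝ :=
  PowerSeries.mk fun j => (prefixCount s k j b : ℝ)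

open PowerSeries in
theorem prefixSeries_succ (s : ℕ → Bool) (k : ℕ) (b : Bool) :
    prefixSeries s (k + 1) b =
      X * (mk 1 * (prefixSeries s k true + prefixSeries s k false)) +
      ((if s k || !b then prefixSeries s k true else 0) +
        if !s k && !b then prefixSeries s k false else 0) := by
  have h : prefixSeries s k true + prefixSeries s k false =
      mk fun j => ((prefixCount s k j true : ℝ) + prefixCount s k j false) := by
    ext j; simp [prefixSeries]
  rw [h, ← mk_sum_range]
  ext j
  simp only [prefixSeries, prefixCount, map_add, coeff_mk]
  push_cast
  split_ifs <;> simp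

open PowerSeries in
-- After an ascent both halves have the same series; after a descent the upper one is `X` times the
-- lower one. Thus a single series evolves: a repeated direction multiplies it by `(1+X)/(1-X)`, a
-- turn downwards by `2/(1-X)` and a turn upwards by `2X/(1-X)`. Each valley collects `4X` from its
-- two turns, and `r` counts the repeated directions.
theorem prefixSeries_eq (s : ℕ → Bool) (k : ℕ) :
    (prevAscent s k = true → ∃ r, k = 2 * valleys s k + r ∧
      prefixSeries s k true = prefixSeries s k false ∧
      prefixSeries s k false = (4 * X) ^ valleys s k * (1 + X) ^ r * mk 1 ^ (k + 1)) ∧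
    (prevAscent s k = false → ∃ r, k = 2 * valleys s k + r + 1 ∧
      prefixSeries s k true = X * prefixSeries s k false ∧
      prefixSeries s k false = 2 * (4 * X) ^ valleys s k * (1 + X) ^ r * mk 1 ^ (k + 1)) := by
  have hu : (mk 1 : PowerSeries ℝ) * (1 - X) = 1 := mk_one_mul_one_sub_eq_one ℝ
  induction k with
  | zero =>
    refine ⟨fun _ => ⟨0, rfl, rfl, ?_⟩, fun h => by simp [prevAscent] at h⟩
    ext j
    simp [prefixSeries, prefixCount, valleys]
  | succ k ih =>
    have hp : prevAscent s (k + 1) = s k := rfl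
    rw [hp]
    rcases hs : s k with _ | _ <;> rcases hb : prevAscent s k with _ | _
    · refine ⟨fun h => by simp at h, fun _ => ?_⟩
      obtain ⟨r, hr, hE, hO⟩ := ih.2 hb
      have hv : valleys s (k + 1) = valleys s k := by simp [valleys, hs]
      rw [hv, prefixSeries_succ, prefixSeries_succ, hE, hO]
      refine ⟨r + 1, by omega, ?_, ?_⟩
      · simp only [hs, Bool.or_false, Bool.not_false, Bool.not_true, Bool.and_false,
          Bool.and_true, Bool.or_true, if_true, Bool.false_eq_true, if_false]
        linear_combination (X * (1 + X) * (2 * (4 * X) ^ valleys s k * (1 + X) ^ r *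
          mk 1 ^ (k + 1))) * hu
      · simp only [hs, Bool.not_false, Bool.and_true, Bool.or_true, if_true]
        linear_combination (-(1 + X) * (2 * (4 * X) ^ valleys s k * (1 + X) ^ r *
          mk 1 ^ (k + 1))) * hu
    · refine ⟨fun h => by simp at h, fun _ => ?_⟩
      obtain ⟨r, hr, hE, hO⟩ := ih.1 hb
      have hv : valleys s (k + 1) = valleys s k := by simp [valleys, hs]
      rw [hv, prefixSeries_succ, prefixSeries_succ, hE, hO]
      refine ⟨r, by omega, ?_, ?_⟩
      · simp only [hs, Bool.or_false, Bool.not_false, Bool.not_true, Bool.and_false,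
          Bool.and_true, Bool.or_true, if_true, Bool.false_eq_true, if_false]
        linear_combination (2 * X * ((4 * X) ^ valleys s k * (1 + X) ^ r *
          mk 1 ^ (k + 1))) * hu
      · simp only [hs, Bool.not_false, Bool.and_true, Bool.or_true, if_true]
        linear_combination (-2 * ((4 * X) ^ valleys s k * (1 + X) ^ r *
          mk 1 ^ (k + 1))) * hu
    · refine ⟨fun _ => ?_, fun h => by simp at h⟩
      obtain ⟨r, hr, hE, hO⟩ := ih.2 hb
      have hv : valleys s (k + 1) = valleys s k + 1 := by simp [valleys, hs, hb]
      rw [hv, prefixSeries_succ, prefixSeries_succ, hE, hO]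
      refine ⟨r, by omega, ?_, ?_⟩
      · simp [hs]
      · simp only [hs, Bool.not_false, Bool.not_true, Bool.and_true, Bool.or_true, if_true,
          Bool.false_eq_true, if_false]
        linear_combination (-X * (2 * (4 * X) ^ valleys s k * (1 + X) ^ r *
          mk 1 ^ (k + 1))) * hu
    · refine ⟨fun _ => ?_, fun h => by simp at h⟩
      obtain ⟨r, hr, hE, hO⟩ := ih.1 hb
      have hv : valleys s (k + 1) = valleys s k := by simp [valleys, hb]
      rw [hv, prefixSeries_succ, prefixSeries_succ, hE, hO]
      refine ⟨r + 1, by omega, ?_, ?_⟩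
      · simp [hs]
      · simp only [hs, Bool.not_false, Bool.not_true, Bool.and_true, Bool.or_true, if_true,
          Bool.false_eq_true, if_false]
        linear_combination (-((4 * X) ^ valleys s k * (1 + X) ^ r *
          mk 1 ^ (k + 1))) * hu

open PowerSeries in
theorem card_chains_eq_coeff (s : ℕ → Bool) (k m : ℕ) : ∃ r, k = 2 * valleys s k + r ∧
    ((chains s k m).card : ℝ) =
      coeff m (2 * X * (4 * X) ^ valleys s k * (1 + X) ^ r * mk 1 ^ (k + 2)) := by
  have h : ((chains s k m).card : ℝ) =
      coeff m (X * (mk 1 * (prefixSeries s k true + prefixSeries s k false))) := by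
    have h' : prefixSeries s k true + prefixSeries s k false =
        mk fun j => ((prefixCount s k j true : ℝ) + prefixCount s k j false) := by
      ext j; simp [prefixSeries]
    rw [h', ← mk_sum_range, card_chains, coeff_mk]
    push_cast
    rfl
  rw [h]
  rcases hb : prevAscent s k with _ | _
  · obtain ⟨r, hr, hE, hO⟩ := (prefixSeries_eq s k).2 hb
    -- The final run of descents has a turn down without its turn up; adding the two halves supplies
    -- a factor `1 + X` in its place.
    refine ⟨r + 1, by omega, ?_⟩
    rw [hE, hO]
    congr 1
    ring
  · obtain ⟨r, hr, hE, hO⟩ := (prefixSeries_eq s k).1 hb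
    refine ⟨r, by omega, ?_⟩
    rw [hE, hO]
    congr 1
    ring

/-! ### The density as a binomial mean -/

open PowerSeries in
theorem coeff_one_add_X_pow_mul (v r k m : ℕ) (h : v + r ≤ m) :
    coeff (m + 1) (2 * X * (4 * X) ^ v * (1 + X) ^ r * mk 1 ^ (k + 1) : PowerSeries ℝ) =
      2 * 4 ^ v * ∑ a ∈ Finset.range (r + 1), (r.choose a : ℝ) *
        ((m - v - a + k).choose k : ℝ) := by
  have e : (2 * X * (4 * X) ^ v * (1 + X) ^ r * mk 1 ^ (k + 1) : PowerSeries ℝ) =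
      ∑ a ∈ Finset.range (r + 1), C (2 * 4 ^ v * (r.choose a : ℝ)) *
        (X ^ (v + a + 1) * mk fun n => (Nat.choose (k + n) k : ℝ)) := by
    rw [← mk_one_pow_eq_mk_choose_add, add_comm (1 : PowerSeries ℝ), add_pow, Finset.mul_sum,
      Finset.sum_mul]
    refine Finset.sum_congr rfl fun a _ => ?_
    simp only [map_mul, map_pow, map_natCast, map_ofNat, one_pow, mul_one]
    ring
  rw [e, map_sum, Finset.mul_sum]
  refine Finset.sum_congr rfl fun a ha => ?_
  have ha' : a ≤ r := by simpa [Nat.lt_succ_iff] using ha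
  rw [coeff_C_mul, coeff_X_pow_mul', if_pos (by omega), coeff_mk, mul_assoc,
    show m + 1 - (v + a + 1) = m - v - a by omega, add_comm k]

/-- The mean of `F` at a centred binomial variable with `N` fair trials. -/
noncomputable def binomialMean (N : ℕ) (F : ℝ → ℝ) : ℝ :=
  ∑ a ∈ Finset.range (N + 1), (N.choose a : ℝ) / 2 ^ N * F (a - N / 2)

/-- The product whose binomial mean is the density of the shelf shuffling measure. -/
noncomputable def shiftedProd (n m : ℕ) (B : ℝ) : ℝ :=
  ∏ i ∈ Finset.range n, (1 + ((i : ℝ) - ((n : ℝ) - 1) / 2 - B) / m)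

theorem measure_div_uniform (k m : ℕ) (hm : k + 1 ≤ m) (w : Equiv.Perm (Fin (k + 1))) :
    ∃ r, k = 2 * valleys (ascents w) k + r ∧
      measure (k + 1) m w / uniform (k + 1) w = binomialMean r (shiftedProd (k + 1) m) := by
  obtain ⟨r, hr, hc⟩ := card_chains_eq_coeff (ascents w) k m
  refine ⟨r, hr, ?_⟩
  obtain ⟨m, rfl⟩ : ∃ m', m = m' + 1 := ⟨m - 1, by omega⟩
  generalize valleys (ascents w) k = v at *
  rw [coeff_one_add_X_pow_mul _ _ _ _ (by omega)] at hc
  rw [measure, card_perm_eq, hc, uniform, binomialMean, div_div_eq_mul_div, div_one,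
    div_mul_eq_mul_div, Finset.mul_sum, Finset.sum_mul, Finset.sum_div]
  refine Finset.sum_congr rfl fun a ha => ?_
  have ha' : a ≤ r := by simpa [Nat.lt_succ_iff] using ha
  -- The factors of the rising factorial are `m + 1 - v - a + i`, and `v + a = (n-1)/2 + B` because
  -- `n - 1 = k = 2v + r` and `B = a - r/2`.
  have hprod : ((m - v - a + (k + 1)).choose (k + 1) : ℝ) * ((k + 1).factorial : ℝ) =
      ((m + 1 : ℕ) : ℝ) ^ (k + 1) * shiftedProd (k + 1) (m + 1) (a - r / 2) := by
    rw [mul_comm, ← Nat.cast_mul, ← Nat.ascFactorial_eq_factorial_mul_choose,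
      Nat.ascFactorial_eq_prod_range, Nat.cast_prod, shiftedProd]
    conv_rhs => rw [← Finset.card_range (k + 1), ← Finset.prod_const, Finset.card_range]
    rw [← Finset.prod_mul_distrib]
    refine Finset.prod_congr rfl fun i _ => ?_
    have hk : (k : ℝ) = 2 * v + r := by exact_mod_cast hr
    have h1 : ((m - v - a : ℕ) : ℝ) = m - v - a := by
      rw [Nat.sub_sub, Nat.cast_sub (by omega)]; push_cast; ring
    have h2 : ((m : ℝ) + 1) ≠ 0 := by positivity
    push_cast
    rw [h1, hk]
    field_simp
    ring
  have hpow : (2 : ℝ) ^ (k + 1) = 2 * 4 ^ v * 2 ^ r := by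
    rw [hr, pow_succ, pow_add, pow_mul]; norm_num; ring
  have h2 : ((m + 1 : ℕ) : ℝ) ^ (k + 1) ≠ 0 := by positivity
  calc _ = 2 * 4 ^ v * (r.choose a : ℝ) * (((m - v - a + (k + 1)).choose (k + 1) : ℝ) *
        ((k + 1).factorial : ℝ)) / (2 * ((m + 1 : ℕ) : ℝ)) ^ (k + 1) := by ring
    _ = _ := by
      rw [hprod, mul_pow, hpow]
      field_simp

end ShelfShuffle

/-! ### Estimates for the product and its binomial mean -/

namespace ShelfShuffle

theorem abs_log_one_add_sub_le {x : ℝ} (hx : |x| ≤ 1 / 2) :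
    |Real.log (1 + x) - (x - x ^ 2 / 2)| ≤ 2 * |x| ^ 3 := by
  have h := Real.abs_log_sub_add_sum_range_le (x := -x) (by rw [abs_neg]; linarith) 2
  rw [abs_neg, sub_neg_eq_add] at h
  have e : Real.log (1 + x) - (x - x ^ 2 / 2) =
      ∑ i ∈ Finset.range 2, (-x) ^ (i + 1) / ((i : ℝ) + 1) + Real.log (1 + x) := by
    simp [Finset.sum_range_succ]; ring
  rw [e]
  refine h.trans ?_
  rw [div_le_iff₀ (by linarith)]
  have h3 : 0 ≤ |x| ^ 3 * (1 - 2 * |x|) := mul_nonneg (by positivity) (by linarith)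
  rw [show 2 + 1 = 3 from rfl]
  linarith

theorem sum_range_cast_sub (n : ℕ) (c : ℝ) :
    ∑ i ∈ Finset.range n, ((i : ℝ) - c) = n * (n - 1) / 2 - n * c := by
  induction n with
  | zero => simp
  | succ n ih => rw [Finset.sum_range_succ, ih]; push_cast; ring

theorem sum_range_cast_sub_sq (n : ℕ) (c : ℝ) :
    ∑ i ∈ Finset.range n, ((i : ℝ) - c) ^ 2 =
      n * (n - 1) * (2 * n - 1) / 6 - n * (n - 1) * c + n * c ^ 2 := by
  induction n with
  | zero => simp
  | succ n ih => rw [Finset.sum_range_succ, ih]; push_cast; ring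

/-- Take logarithms: the deviations `x i` have size at most `n/m ≤ 1/2`, their sum and sum of
squares are explicit, and the cubic remainders add up to `e`. -/
theorem shiftedProd_eq_exp {n m : ℕ} (hm : 0 < m) (hnm : 2 * n ≤ m) {B : ℝ}
    (hB : |B| ≤ (n : ℝ) / 2) : ∃ e : ℝ, |e| ≤ 2 * n * ((n : ℝ) / m) ^ 3 ∧
      shiftedProd n m B = Real.exp (-((n : ℝ) / m * B) -
        (n * ((n : ℝ) ^ 2 - 1) / 12 + n * B ^ 2) / (2 * (m : ℝ) ^ 2) + e) := by
  have hm' : (0 : ℝ) < m := by exact_mod_cast hm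
  have hnm' : (n : ℝ) / m ≤ 1 / 2 := by
    rw [div_le_iff₀ hm']
    have : (2 * n : ℝ) ≤ m := by exact_mod_cast hnm
    linarith
  set x : ℕ → ℝ := fun i => ((i : ℝ) - ((n : ℝ) - 1) / 2 - B) / m with hx
  have hxn : ∀ i ∈ Finset.range n, |x i| ≤ (n : ℝ) / m := by
    intro i hi
    have hi' : (i : ℝ) + 1 ≤ n := by exact_mod_cast Finset.mem_range.1 hi
    have hi0 : (0 : ℝ) ≤ i := Nat.cast_nonneg i
    rw [hx, abs_div, abs_of_pos hm']
    gcongr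
    rw [abs_le] at hB ⊢
    constructor <;> linarith [hB.1, hB.2]
  have hpos : ∀ i ∈ Finset.range n, 0 < 1 + x i := by
    intro i hi
    have := (abs_le.1 ((hxn i hi).trans hnm')).1
    linarith
  refine ⟨∑ i ∈ Finset.range n, (Real.log (1 + x i) - (x i - x i ^ 2 / 2)), ?_, ?_⟩
  · refine (Finset.abs_sum_le_sum_abs _ _).trans ?_
    calc _ ≤ ∑ i ∈ Finset.range n, 2 * ((n : ℝ) / m) ^ 3 := by
          refine Finset.sum_le_sum fun i hi => ?_
          refine (abs_log_one_add_sub_le ((hxn i hi).trans hnm')).trans ?_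
          have := hxn i hi
          gcongr
      _ = _ := by simp; ring
  · have h1 : ∑ i ∈ Finset.range n, x i = -((n : ℝ) / m * B) := by
      have := sum_range_cast_sub n (((n : ℝ) - 1) / 2 + B)
      rw [hx, ← Finset.sum_div]
      simp only [sub_sub]
      rw [this]
      field_simp
      ring
    have h2 : ∑ i ∈ Finset.range n, x i ^ 2 =
        (n * ((n : ℝ) ^ 2 - 1) / 12 + n * B ^ 2) / (m : ℝ) ^ 2 := by
      have := sum_range_cast_sub_sq n (((n : ℝ) - 1) / 2 + B)
      simp only [hx, div_pow]
      rw [← Finset.sum_div]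
      simp only [sub_sub]
      rw [this]
      congr 1
      ring
    rw [Finset.sum_sub_distrib, Finset.sum_sub_distrib, h1, ← Finset.sum_div (Finset.range n) (fun i => x i ^ 2), h2,
      ← Real.log_prod (fun i hi => (hpos i hi).ne')]
    have h3 : shiftedProd n m B = ∏ i ∈ Finset.range n, (1 + x i) := rfl
    rw [← h3]
    have h4 : 0 < shiftedProd n m B := h3 ▸ Finset.prod_pos hpos
    conv_lhs => rw [← Real.exp_log h4]
    congr 1
    field_simp
    ring

theorem binomialMean_mono {N : ℕ} {F G : ℝ → ℝ}
    (h : ∀ B : ℝ, |B| ≤ (N : ℝ) / 2 → F B ≤ G B) : binomialMean N F ≤ binomialMean N G := by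
  refine Finset.sum_le_sum fun a ha => ?_
  refine mul_le_mul_of_nonneg_left (h _ ?_) (by positivity)
  have : (a : ℝ) ≤ N := by exact_mod_cast Nat.lt_succ_iff.1 (Finset.mem_range.1 ha)
  rw [abs_le]
  constructor <;> linarith [(Nat.cast_nonneg a : (0 : ℝ) ≤ a)]

theorem binomialMean_const_mul (N : ℕ) (c : ℝ) (F : ℝ → ℝ) :
    binomialMean N (fun B => c * F B) = c * binomialMean N F := by
  simp only [binomialMean, Finset.mul_sum]
  exact Finset.sum_congr rfl fun _ _ => by ring

theorem binomialMean_add (N : ℕ) (F G : ℝ → ℝ) :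
    binomialMean N (fun B => F B + G B) = binomialMean N F + binomialMean N G := by
  simp only [binomialMean, mul_add, Finset.sum_add_distrib]

theorem binomialMean_sub (N : ℕ) (F G : ℝ → ℝ) :
    binomialMean N (fun B => F B - G B) = binomialMean N F - binomialMean N G := by
  simp only [binomialMean, mul_sub, Finset.sum_sub_distrib]

theorem binomialMean_exp (N : ℕ) (t : ℝ) :
    binomialMean N (fun B => Real.exp (-(t * B))) = Real.cosh (t / 2) ^ N := by
  rw [Real.cosh_eq, div_pow, add_comm, add_pow, Finset.sum_div, binomialMean]
  refine Finset.sum_congr rfl fun a ha => ?_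
  have ha' : a ≤ N := Nat.lt_succ_iff.1 (Finset.mem_range.1 ha)
  rw [← Real.exp_nat_mul, ← Real.exp_nat_mul, ← Real.exp_add, Nat.cast_sub ha',
    show (a : ℝ) * -(t / 2) + ((N : ℝ) - a) * (t / 2) = -(t * (a - N / 2)) by ring]
  ring

theorem cosh_half_pow_le (N : ℕ) (t : ℝ) :
    Real.cosh (t / 2) ^ N ≤ Real.exp (N * t ^ 2 / 8) := by
  refine (pow_le_pow_left₀ (Real.cosh_pos _).le (Real.cosh_le_exp_half_sq _) N).trans_eq ?_
  rw [← Real.exp_nat_mul]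
  congr 1
  ring

theorem one_add_sq_div_le_cosh_half (t : ℝ) : 1 + t ^ 2 / 8 ≤ Real.cosh (t / 2) := by
  have h1 : Real.cosh (t / 2) = 1 + 2 * Real.sinh (t / 4) ^ 2 := by
    rw [show t / 2 = 2 * (t / 4) by ring, Real.cosh_two_mul, Real.cosh_sq]; ring
  have h2 : (t / 4) ^ 2 ≤ Real.sinh (t / 4) ^ 2 := by
    rw [← sq_abs, ← sq_abs (Real.sinh _), Real.abs_sinh]
    exact pow_le_pow_left₀ (abs_nonneg _) (Real.self_le_sinh_iff.2 (abs_nonneg _)) 2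
  rw [h1]
  nlinarith

/-- The term in `B²` only lowers the product, so it is dropped; the rest is a moment generating
function. -/
theorem binomialMean_shiftedProd_le {n m N : ℕ} (hm : 0 < m) (hnm : 2 * n ≤ m) (hN : N ≤ n) :
    binomialMean N (shiftedProd n m) ≤
      Real.exp (2 * n * ((n : ℝ) / m) ^ 3 - n * ((n : ℝ) ^ 2 - 1) / (24 * (m : ℝ) ^ 2) +
        N * ((n : ℝ) / m) ^ 2 / 8) := by
  have hN' : (N : ℝ) ≤ n := by exact_mod_cast hN
  rw [Real.exp_add]
  refine le_trans ?_ (mul_le_mul_of_nonneg_left (cosh_half_pow_le N _) (Real.exp_pos _).le)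
  rw [← binomialMean_exp, ← binomialMean_const_mul]
  refine binomialMean_mono fun B hB => ?_
  obtain ⟨e, he, h⟩ := shiftedProd_eq_exp hm hnm (B := B) (hB.trans (by linarith))
  rw [h, ← Real.exp_add, Real.exp_le_exp]
  have h1 : (n * ((n : ℝ) ^ 2 - 1) / 12 + n * B ^ 2) / (2 * (m : ℝ) ^ 2) =
      n * ((n : ℝ) ^ 2 - 1) / (24 * (m : ℝ) ^ 2) + n * B ^ 2 / (2 * (m : ℝ) ^ 2) := by
    field_simp; ring
  have h2 : 0 ≤ n * B ^ 2 / (2 * (m : ℝ) ^ 2) := by positivity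
  rw [h1]
  linarith [(abs_le.1 he).2]

/-- The factor `exp(-nB²/(2m²))` is bounded below by `1 - nB²/(2m²)`, and `B²` by exponentials of
`B`, so every mean needed is again a power of `cosh`. -/
theorem le_binomialMean_shiftedProd {n m N : ℕ} (hn : 0 < n) (hm : 0 < m) (hnm : 2 * n ≤ m)
    (hN : N ≤ n) :
    Real.exp (-(2 * n * ((n : ℝ) / m) ^ 3) - n * ((n : ℝ) ^ 2 - 1) / (24 * (m : ℝ) ^ 2)) *
      ((1 + ((n : ℝ) / m) ^ 2 / 8) ^ N -
        ((n : ℝ) / m) ^ 2 * Real.exp ((n * ((n : ℝ) / m) ^ 2 + 1) / 4)) ≤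
      binomialMean N (shiftedProd n m) := by
  have hN' : (N : ℝ) ≤ n := by exact_mod_cast hN
  have hn' : (0 : ℝ) < n := by exact_mod_cast hn
  have hm' : (0 : ℝ) < m := by exact_mod_cast hm
  set θ : ℝ := (n : ℝ) / m with hθ
  -- The natural scale: `B` has order at most `√n`, so the means of `exp(±σB)` stay bounded.
  set σ : ℝ := 1 / √n with hσ
  have hσ2 : σ ^ 2 = 1 / n := by rw [hσ, div_pow, Real.sq_sqrt hn'.le, one_pow]
  have hbd : ∀ t : ℝ, t ^ 2 ≤ 2 * θ ^ 2 + 2 * σ ^ 2 →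
      Real.cosh (t / 2) ^ N ≤ Real.exp ((n * θ ^ 2 + 1) / 4) := by
    intro t ht
    refine (cosh_half_pow_le N t).trans (Real.exp_le_exp.2 ?_)
    have h1 : N * t ^ 2 ≤ n * (2 * θ ^ 2 + 2 * σ ^ 2) := by gcongr
    have h2 : n * (2 * θ ^ 2 + 2 * σ ^ 2) = 2 * (n * θ ^ 2) + 2 := by
      rw [hσ2]; field_simp
    linarith
  have key : Real.exp (-(2 * n * θ ^ 3) - n * ((n : ℝ) ^ 2 - 1) / (24 * (m : ℝ) ^ 2)) *
      (Real.cosh (θ / 2) ^ N - θ ^ 2 / 2 *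
        (Real.cosh ((θ - σ) / 2) ^ N + Real.cosh ((θ + σ) / 2) ^ N)) ≤
      binomialMean N (shiftedProd n m) := by
    rw [← binomialMean_exp, ← binomialMean_exp, ← binomialMean_exp, ← binomialMean_add,
      ← binomialMean_const_mul, ← binomialMean_sub, ← binomialMean_const_mul]
    refine binomialMean_mono fun B hB => ?_
    obtain ⟨e, he, h⟩ := shiftedProd_eq_exp hm hnm (B := B) (hB.trans (by linarith))
    have h1 : (n * ((n : ℝ) ^ 2 - 1) / 12 + n * B ^ 2) / (2 * (m : ℝ) ^ 2) =
        n * ((n : ℝ) ^ 2 - 1) / (24 * (m : ℝ) ^ 2) + n * B ^ 2 / (2 * (m : ℝ) ^ 2) := by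
      field_simp; ring
    have h2 : Real.exp (-(2 * n * θ ^ 3) - n * ((n : ℝ) ^ 2 - 1) / (24 * (m : ℝ) ^ 2)) *
        (Real.exp (-(θ * B)) * Real.exp (-(n * B ^ 2 / (2 * (m : ℝ) ^ 2)))) ≤
        shiftedProd n m B := by
      rw [h, ← Real.exp_add, ← Real.exp_add, Real.exp_le_exp, h1]
      linarith [(abs_le.1 he).1]
    refine le_trans ?_ h2
    refine mul_le_mul_of_nonneg_left ?_ (Real.exp_pos _).le
    have h3 : (σ * B) ^ 2 ≤ Real.exp (σ * B) + Real.exp (-(σ * B)) := by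
      have := one_add_sq_div_le_cosh_half (2 * (σ * B))
      rw [mul_div_cancel_left₀ _ (two_ne_zero), Real.cosh_eq] at this
      linarith
    have h4 : n * B ^ 2 / (2 * (m : ℝ) ^ 2) = θ ^ 2 / 2 * (σ * B) ^ 2 := by
      rw [mul_pow, hσ2, hθ]; field_simp
    have h5 : 1 - θ ^ 2 / 2 * (Real.exp (σ * B) + Real.exp (-(σ * B))) ≤
        Real.exp (-(n * B ^ 2 / (2 * (m : ℝ) ^ 2))) := by
      refine le_trans ?_ (Real.one_sub_le_exp_neg _)
      rw [h4]
      gcongr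
    calc _ = Real.exp (-(θ * B)) *
          (1 - θ ^ 2 / 2 * (Real.exp (σ * B) + Real.exp (-(σ * B)))) := by
          rw [show -((θ - σ) * B) = -(θ * B) + σ * B by ring,
            show -((θ + σ) * B) = -(θ * B) + -(σ * B) by ring, Real.exp_add, Real.exp_add]
          ring
      _ ≤ _ := mul_le_mul_of_nonneg_left h5 (Real.exp_pos _).le
  refine le_trans (mul_le_mul_of_nonneg_left ?_ (Real.exp_pos _).le) key
  have h1 := hbd (θ - σ) (by nlinarith [sq_nonneg (θ + σ)])
  have h2 := hbd (θ + σ) (by nlinarith [sq_nonneg (θ - σ)])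
  have h3 : (1 + θ ^ 2 / 8) ^ N ≤ Real.cosh (θ / 2) ^ N :=
    pow_le_pow_left₀ (by positivity) (one_add_sq_div_le_cosh_half θ) N
  have h4 := mul_le_mul_of_nonneg_left (add_le_add h1 h2) (by positivity : 0 ≤ θ ^ 2 / 2)
  linarith

end ShelfShuffle

/-! ### Extremal permutations and bounds for both distances -/

namespace ShelfShuffle

theorem valleys_ascents_refl (k : ℕ) : valleys (ascents (Equiv.refl (Fin (k + 1)))) k = 0 := by
  have h : ∀ i, ascents (Equiv.refl (Fin (k + 1))) i = true := by
    intro i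
    unfold ascents
    split_ifs
    · simp
    · rfl
  have h' : ∀ i, prevAscent (ascents (Equiv.refl (Fin (k + 1)))) i = true := by
    rintro (_ | i)
    · rfl
    · exact h i
  have : ∀ j, valleys (ascents (Equiv.refl (Fin (k + 1)))) j = 0 := by
    intro j
    induction j with
    | zero => rfl
    | succ j ih => simp [valleys, ih, h']
  exact this k

/-- A permutation that starts with a descent and then alternates. -/
noncomputable def alternating (k : ℕ) : Equiv.Perm (Fin (k + 1)) :=
  Equiv.ofBijective (fun i => if (i : ℕ) % 2 = 0 then ⟨k - i / 2, by omega⟩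
    else ⟨i / 2, by omega⟩) <| by
    refine Finite.injective_iff_bijective.1 fun i j h => ?_
    have hi := i.2
    have hj := j.2
    ext
    split_ifs at h <;> simp only [Fin.mk.injEq] at h <;> omega

theorem ascents_alternating {k i : ℕ} (hi : i < k) :
    ascents (alternating k) i = decide (i % 2 = 1) := by
  simp only [ascents, dif_pos hi, alternating, Equiv.ofBijective_apply]
  rcases Nat.mod_two_eq_zero_or_one i with h | h
  · have h' : (i + 1) % 2 = 1 := by omega
    simp [h, h']
    omega
  · have h' : (i + 1) % 2 = 0 := by omega
    simp [h, h']
    omega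

theorem valleys_ascents_alternating (k : ℕ) : valleys (ascents (alternating k)) k = k / 2 := by
  have : ∀ j ≤ k, valleys (ascents (alternating k)) j = j / 2 := by
    intro j hj
    induction j with
    | zero => rfl
    | succ j ih =>
      rw [valleys, ih (by omega), ascents_alternating (by omega)]
      cases j with
      | zero => simp
      | succ j =>
        rw [prevAscent, ascents_alternating (by omega)]
        rcases Nat.mod_two_eq_zero_or_one j with h | h
        · have h' : (j + 1) % 2 = 1 := by omega
          simp [h, h']
          omega
        · have h' : (j + 1) % 2 = 0 := by omega
          simp [h, h']
          omega
  exact this k le_rfl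

/-- Upper bound for the density of the shelf shuffling measure at permutations with
`n - 1 - N` comparisons in valleys. -/
noncomputable def upperBound (n m : ℕ) (x : ℝ) : ℝ :=
  Real.exp (2 * n * ((n : ℝ) / m) ^ 3 - n * ((n : ℝ) ^ 2 - 1) / (24 * (m : ℝ) ^ 2) +
    x * ((n : ℝ) / m) ^ 2 / 8)

/-- Lower bound for the density of the shelf shuffling measure at permutations with
`n - 1 - N` comparisons in valleys. -/
noncomputable def lowerBound (n m N : ℕ) : ℝ :=
  Real.exp (-(2 * n * ((n : ℝ) / m) ^ 3) - n * ((n : ℝ) ^ 2 - 1) / (24 * (m : ℝ) ^ 2)) *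
    ((1 + ((n : ℝ) / m) ^ 2 / 8) ^ N -
      ((n : ℝ) / m) ^ 2 * Real.exp ((n * ((n : ℝ) / m) ^ 2 + 1) / 4))

section Bounds

variable {n m : ℕ}

theorem measure_div_uniform_bounds (hn : 0 < n) (hnm : 2 * n ≤ m) (w : Equiv.Perm (Fin n)) :
    lowerBound n m 0 ≤ measure n m w / uniform n w ∧
      measure n m w / uniform n w ≤ upperBound n m n := by
  obtain ⟨k, rfl⟩ : ∃ k, n = k + 1 := ⟨n - 1, by omega⟩
  obtain ⟨r, hr, h⟩ := measure_div_uniform k m (by omega) w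
  have hr' : (r : ℝ) ≤ (k + 1 : ℕ) := by exact_mod_cast (by omega : r ≤ k + 1)
  rw [h]
  constructor
  · refine le_trans ?_ (le_binomialMean_shiftedProd (N := r) hn (by omega) hnm (by omega))
    refine mul_le_mul_of_nonneg_left (sub_le_sub_right ?_ _) (Real.exp_pos _).le
    rw [pow_zero]
    exact one_le_pow₀ (by linarith [sq_nonneg (((k + 1 : ℕ) : ℝ) / m)])
  · refine (binomialMean_shiftedProd_le (N := r) (by omega) hnm (by omega)).trans ?_
    refine Real.exp_le_exp.2 ?_
    gcongr

theorem exists_lowerBound_le (hn : 0 < n) (hnm : 2 * n ≤ m) :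
    ∃ w : Equiv.Perm (Fin n), lowerBound n m (n - 1) ≤ measure n m w / uniform n w := by
  obtain ⟨k, rfl⟩ : ∃ k, n = k + 1 := ⟨n - 1, by omega⟩
  refine ⟨Equiv.refl _, ?_⟩
  obtain ⟨r, hr, h⟩ := measure_div_uniform k m (by omega) (Equiv.refl _)
  rw [valleys_ascents_refl] at hr
  obtain rfl : r = k := by omega
  rw [h]
  exact le_binomialMean_shiftedProd hn (by omega) hnm (by omega)

theorem exists_le_upperBound (hn : 0 < n) (hnm : 2 * n ≤ m) :
    ∃ w : Equiv.Perm (Fin n), measure n m w / uniform n w ≤ upperBound n m 1 := by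
  obtain ⟨k, rfl⟩ : ∃ k, n = k + 1 := ⟨n - 1, by omega⟩
  refine ⟨alternating k, ?_⟩
  obtain ⟨r, hr, h⟩ := measure_div_uniform k m (by omega) (alternating k)
  rw [valleys_ascents_alternating] at hr
  -- With `k / 2` valleys, `r` is the parity of `k`.
  have hr' : (r : ℝ) ≤ 1 := by exact_mod_cast (by omega : r ≤ 1)
  rw [h]
  refine (binomialMean_shiftedProd_le (N := r) (by omega) hnm (by omega)).trans ?_
  refine Real.exp_le_exp.2 ?_
  gcongr

theorem sep_bounds (hn : 0 < n) (hnm : 2 * n ≤ m) :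
    1 - upperBound n m 1 ≤ sep (measure n m) ∧ sep (measure n m) ≤ 1 - lowerBound n m 0 := by
  constructor
  · obtain ⟨w, hw⟩ := exists_le_upperBound hn hnm
    exact (sub_le_sub_left hw 1).trans
      (Finset.le_sup' (fun w => 1 - measure n m w / uniform n w) (Finset.mem_univ w))
  · exact Finset.sup'_le _ _ fun w _ => sub_le_sub_left (measure_div_uniform_bounds hn hnm w).1 1

theorem linfDist_bounds (hn : 0 < n) (hnm : 2 * n ≤ m) :
    lowerBound n m (n - 1) - 1 ≤ linfDist (measure n m) ∧
      linfDist (measure n m) ≤ max (upperBound n m n - 1) (1 - lowerBound n m 0) := by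
  constructor
  · obtain ⟨w, hw⟩ := exists_lowerBound_le hn hnm
    refine le_trans ?_
      (Finset.le_sup' (fun w => |1 - measure n m w / uniform n w|) (Finset.mem_univ w))
    rw [abs_sub_comm]
    exact (sub_le_sub_right hw 1).trans (le_abs_self _)
  · refine Finset.sup'_le _ _ fun w _ => ?_
    obtain ⟨h1, h2⟩ := measure_div_uniform_bounds hn hnm w
    refine abs_le'.2 ⟨le_max_of_le_right (by linarith), le_max_of_le_left (by linarith)⟩

end Bounds

/-! ### Limits of the bounds in the regime `m ~ c n^(3/2)` -/

section Limits

variable {c : ℝ} {m : ℕ → ℕ}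

theorem tendsto_mul_div_sq (hc : 0 < c)
    (hm : Tendsto (fun n : ℕ => (m n : ℝ) / (n : ℝ) ^ (3 / 2 : ℝ)) atTop (𝓝 c)) :
    Tendsto (fun n : ℕ => n * ((n : ℝ) / m n) ^ 2) atTop (𝓝 (1 / c ^ 2)) := by
  have h := (hm.pow 2).inv₀ (by positivity)
  rw [one_div]
  refine h.congr fun n => ?_
  have e : ((n : ℝ) ^ (3 / 2 : ℝ)) ^ 2 = (n : ℝ) ^ 3 := by
    rw [← Real.rpow_natCast, ← Real.rpow_mul (Nat.cast_nonneg n), ← Real.rpow_natCast]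
    norm_num
  rw [div_pow, e, inv_div]
  ring

theorem tendsto_div_sq (hc : 0 < c)
    (hm : Tendsto (fun n : ℕ => (m n : ℝ) / (n : ℝ) ^ (3 / 2 : ℝ)) atTop (𝓝 c)) :
    Tendsto (fun n : ℕ => ((n : ℝ) / m n) ^ 2) atTop (𝓝 0) := by
  have h := (tendsto_mul_div_sq hc hm).mul tendsto_inv_atTop_nhds_zero_nat
  rw [mul_zero] at h
  refine h.congr' ?_
  filter_upwards [eventually_gt_atTop 0] with n hn
  have : (n : ℝ) ≠ 0 := by positivity
  field_simp

theorem tendsto_div (hc : 0 < c)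
    (hm : Tendsto (fun n : ℕ => (m n : ℝ) / (n : ℝ) ^ (3 / 2 : ℝ)) atTop (𝓝 c)) :
    Tendsto (fun n : ℕ => (n : ℝ) / m n) atTop (𝓝 0) := by
  have h := (tendsto_div_sq hc hm).sqrt
  rw [Real.sqrt_zero] at h
  exact h.congr fun n => Real.sqrt_sq (by positivity)

theorem eventually_two_mul_le (hc : 0 < c)
    (hm : Tendsto (fun n : ℕ => (m n : ℝ) / (n : ℝ) ^ (3 / 2 : ℝ)) atTop (𝓝 c)) :
    ∀ᶠ n in atTop, 0 < n ∧ 2 * n ≤ m n := by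
  filter_upwards [eventually_gt_atTop 0, hm.eventually_const_lt hc,
    (tendsto_div hc hm).eventually_lt_const (show (0 : ℝ) < 1 / 2 by norm_num)] with n hn h1 h2
  refine ⟨hn, ?_⟩
  -- Since division by zero gives zero, `h2` does not exclude `m n = 0`; `h1` does.
  have hm0 : (0 : ℝ) < m n := by
    by_contra h
    have h0 : (m n : ℝ) = 0 := le_antisymm (not_lt.1 h) (Nat.cast_nonneg _)
    simp [h0] at h1
  rw [div_lt_iff₀ hm0] at h2
  have : (2 * n : ℝ) ≤ m n := by linarith
  exact_mod_cast this

theorem tendsto_cube (hc : 0 < c)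
    (hm : Tendsto (fun n : ℕ => (m n : ℝ) / (n : ℝ) ^ (3 / 2 : ℝ)) atTop (𝓝 c)) :
    Tendsto (fun n : ℕ => 2 * n * ((n : ℝ) / m n) ^ 3) atTop (𝓝 0) := by
  have h := ((tendsto_mul_div_sq hc hm).mul (tendsto_div hc hm)).const_mul 2
  rw [mul_zero, mul_zero] at h
  exact h.congr fun n => by ring

theorem tendsto_variance_term (hc : 0 < c)
    (hm : Tendsto (fun n : ℕ => (m n : ℝ) / (n : ℝ) ^ (3 / 2 : ℝ)) atTop (𝓝 c)) :
    Tendsto (fun n : ℕ => n * ((n : ℝ) ^ 2 - 1) / (24 * (m n : ℝ) ^ 2)) atTop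
      (𝓝 (1 / (24 * c ^ 2))) := by
  have h := ((tendsto_mul_div_sq hc hm).sub
    ((tendsto_div_sq hc hm).mul tendsto_inv_atTop_nhds_zero_nat)).div_const 24
  rw [mul_zero, sub_zero, div_div, mul_comm (c ^ 2)] at h
  refine h.congr' ?_
  filter_upwards [eventually_two_mul_le hc hm] with n hn
  have h1 : (n : ℝ) ≠ 0 := by exact_mod_cast hn.1.ne'
  have h2 : (m n : ℝ) ≠ 0 := by exact_mod_cast (by omega : m n ≠ 0)
  field_simp

theorem tendsto_upperBound (hc : 0 < c)
    (hm : Tendsto (fun n : ℕ => (m n : ℝ) / (n : ℝ) ^ (3 / 2 : ℝ)) atTop (𝓝 c)) :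
    Tendsto (fun n : ℕ => upperBound n (m n) n) atTop (𝓝 (Real.exp (1 / (12 * c ^ 2)))) := by
  have h := ((tendsto_cube hc hm).sub (tendsto_variance_term hc hm)).add
    ((tendsto_mul_div_sq hc hm).div_const 8)
  rw [show 0 - 1 / (24 * c ^ 2) + 1 / c ^ 2 / 8 = 1 / (12 * c ^ 2) by field_simp; norm_num] at h
  exact (Real.continuous_exp.tendsto _).comp h

theorem tendsto_upperBound_one (hc : 0 < c)
    (hm : Tendsto (fun n : ℕ => (m n : ℝ) / (n : ℝ) ^ (3 / 2 : ℝ)) atTop (𝓝 c)) :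
    Tendsto (fun n : ℕ => upperBound n (m n) 1) atTop (𝓝 (Real.exp (-1 / (24 * c ^ 2)))) := by
  have h := ((tendsto_cube hc hm).sub (tendsto_variance_term hc hm)).add
    (((tendsto_div_sq hc hm).const_mul 1).div_const 8)
  rw [show 0 - 1 / (24 * c ^ 2) + 1 * 0 / 8 = -1 / (24 * c ^ 2) by ring] at h
  exact (Real.continuous_exp.tendsto _).comp h

theorem tendsto_lowerBound {N : ℕ → ℕ} {L : ℝ} (hc : 0 < c)
    (hm : Tendsto (fun n : ℕ => (m n : ℝ) / (n : ℝ) ^ (3 / 2 : ℝ)) atTop (𝓝 c))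
    (hN : Tendsto (fun n : ℕ => (1 + ((n : ℝ) / m n) ^ 2 / 8) ^ N n) atTop (𝓝 L)) :
    Tendsto (fun n : ℕ => lowerBound n (m n) (N n)) atTop
      (𝓝 (Real.exp (-1 / (24 * c ^ 2)) * L)) := by
  have h1 := (tendsto_cube hc hm).neg.sub (tendsto_variance_term hc hm)
  rw [show -0 - 1 / (24 * c ^ 2) = -1 / (24 * c ^ 2) by ring] at h1
  have h2 := (tendsto_div_sq hc hm).mul ((Real.continuous_exp.tendsto _).comp
    (((tendsto_mul_div_sq hc hm).add_const 1).div_const 4))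
  rw [zero_mul] at h2
  have h3 := hN.sub h2
  rw [sub_zero] at h3
  exact ((Real.continuous_exp.tendsto _).comp h1).mul h3

theorem tendsto_lowerBound_zero (hc : 0 < c)
    (hm : Tendsto (fun n : ℕ => (m n : ℝ) / (n : ℝ) ^ (3 / 2 : ℝ)) atTop (𝓝 c)) :
    Tendsto (fun n : ℕ => lowerBound n (m n) 0) atTop (𝓝 (Real.exp (-1 / (24 * c ^ 2)))) := by
  have h := tendsto_lowerBound (N := fun _ => 0) (L := 1) hc hm (by simp)
  rwa [mul_one] at h

theorem tendsto_lowerBound_sub_one (hc : 0 < c)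
    (hm : Tendsto (fun n : ℕ => (m n : ℝ) / (n : ℝ) ^ (3 / 2 : ℝ)) atTop (𝓝 c)) :
    Tendsto (fun n : ℕ => lowerBound n (m n) (n - 1)) atTop
      (𝓝 (Real.exp (1 / (12 * c ^ 2)))) := by
  have h1 : Tendsto (fun n : ℕ => n * (((n : ℝ) / m n) ^ 2 / 8)) atTop (𝓝 (1 / c ^ 2 / 8)) :=
    ((tendsto_mul_div_sq hc hm).div_const 8).congr fun n => by ring
  -- The exponent `n - 1` is reached from `n` by dividing by one factor, which tends to `1`.
  have h2 := (Real.tendsto_one_add_pow_exp_of_tendsto h1).div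
    (((tendsto_div_sq hc hm).div_const 8).const_add 1) (by norm_num)
  rw [zero_div, add_zero, div_one] at h2
  have h3 := tendsto_lowerBound (N := fun n => n - 1) hc hm (h2.congr' ?_)
  · rwa [← Real.exp_add, show -1 / (24 * c ^ 2) + 1 / c ^ 2 / 8 = 1 / (12 * c ^ 2) by
      field_simp; norm_num] at h3
  · filter_upwards [eventually_gt_atTop 0] with n hn
    have h4 : 1 + ((n : ℝ) / m n) ^ 2 / 8 ≠ 0 := by positivity
    obtain ⟨k, rfl⟩ : ∃ k, n = k + 1 := ⟨n - 1, by omega⟩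
    rw [Pi.div_apply, pow_succ, mul_div_cancel_right₀ _ h4, Nat.add_sub_cancel]

end Limits

end ShelfShuffle

theorem theorem3p3 (c : ℝ) (hc : 0 < c) (m : ℕ → ℕ)
    (hm : Tendsto (fun n : ℕ => (m n : ℝ) / (n : ℝ) ^ (3 / 2 : ℝ)) atTop (𝓝 c)) :
    ((fun n : ℕ => ShelfShuffle.linfDist (ShelfShuffle.measure n (m n))) ~[atTop]
        fun _ => Real.exp (1 / (12 * c ^ 2)) - 1) ∧
      ((fun n : ℕ => ShelfShuffle.sep (ShelfShuffle.measure n (m n))) ~[atTop]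
        fun _ => 1 - Real.exp (-1 / (24 * c ^ 2))) := by
  have hpos : 0 < 1 / (24 * c ^ 2) := by positivity
  have e1 : 1 / (12 * c ^ 2) = 2 * (1 / (24 * c ^ 2)) := by field_simp; norm_num
  have e2 : -1 / (24 * c ^ 2) = -(1 / (24 * c ^ 2)) := by ring
  have hev := ShelfShuffle.eventually_two_mul_le hc hm
  constructor
  · have hne : Real.exp (1 / (12 * c ^ 2)) - 1 ≠ 0 :=
      (sub_pos.2 (Real.one_lt_exp_iff.2 (by positivity))).ne'
    refine (isEquivalent_const_iff_tendsto hne).2 ?_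
    -- With `x = 1/(24c²)`: `e^(2x) - 1 ≥ 2x ≥ x ≥ 1 - e^(-x)`, so the excess over uniform outweighs
    -- the deficit.
    have hmax : max (Real.exp (1 / (12 * c ^ 2)) - 1) (1 - Real.exp (-1 / (24 * c ^ 2))) =
        Real.exp (1 / (12 * c ^ 2)) - 1 := by
      refine max_eq_left ?_
      have h1 := Real.add_one_le_exp (1 / (12 * c ^ 2))
      have h2 := Real.add_one_le_exp (-1 / (24 * c ^ 2))
      rw [e1, e2] at *
      linarith
    have hup := ((ShelfShuffle.tendsto_upperBound hc hm).sub_const 1).max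
      ((ShelfShuffle.tendsto_lowerBound_zero hc hm).const_sub 1)
    rw [hmax] at hup
    exact tendsto_of_tendsto_of_tendsto_of_le_of_le'
      ((ShelfShuffle.tendsto_lowerBound_sub_one hc hm).sub_const 1) hup
      (hev.mono fun n hn => (ShelfShuffle.linfDist_bounds hn.1 hn.2).1)
      (hev.mono fun n hn => (ShelfShuffle.linfDist_bounds hn.1 hn.2).2)
  · have hne : 1 - Real.exp (-1 / (24 * c ^ 2)) ≠ 0 := by
      rw [e2]
      exact (sub_pos.2 (Real.exp_lt_one_iff.2 (neg_lt_zero.2 hpos))).ne'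
    refine (isEquivalent_const_iff_tendsto hne).2 ?_
    exact tendsto_of_tendsto_of_tendsto_of_le_of_le'
      ((ShelfShuffle.tendsto_upperBound_one hc hm).const_sub 1)
      ((ShelfShuffle.tendsto_lowerBound_zero hc hm).const_sub 1)
      (hev.mono fun n hn => (ShelfShuffle.sep_bounds hn.1 hn.2).1)
      (hev.mono fun n hn => (ShelfShuffle.sep_bounds hn.1 hn.2).2)
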